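/- Fix a countably infinite set $\mathbf{dom}$ and a nonempty countable (finite or infinite) set $\mathbb V$ of variables, with an arbitrary injective numbering of $\mathbb V$ by natural numbers. A vocabulary $\mathcal S$ is a nonempty set of module names $M$, each with an arity $\mathrm{ar}(M)$ and an input arity $\mathrm{iar}(M)\le \mathrm{ar}(M)$; an interpretation $D$ assigns to each $M$ an $\mathrm{ar}(M)$-ary relation $D(M)$ on $\mathbf{dom}$. A valuation is a map $\nu:\mathbb V\to\mathbf{dom}$. LIF expressions over $\mathcal S$ are $$\alpha ::= \mathit{id}\mid M(\bar x;\bar y)\mid \alpha\cup\alpha\mid\alpha\cap\alpha\mid\alpha\setminus\alpha\mid\alpha\,;\alpha\mid \mathrm{cyl}^l_Z(\alpha)\mid \mathrm{cyl}^r_Z(\alpha)\mid\sigma^{lr}_{x=y}(\alpha)\mid\sigma^l_{x=y}(\alpha)\mid\sigma^r_{x=y}(\alpha),$$ where $Z\subseteq\mathbb V$ is finite, $x,y\in\mathbb V$, and $\bar x,\bar y$ are tuples of variables of lengths $\mathrm{iar}(M)$ and $\mathrm{ar}(M)-\mathrm{iar}(M)$. For an interpretation $D$, the expression $\alpha$ denotes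 a binary relation $[\![\alpha]\!]_D$ on valuations: $[\![\mathit{id}]\!]_D$ is the identity; $(\nu_1,\nu_2)\in[\![M(\bar x;\bar y)]\!]_D$ iff $\nu_1(\bar x)\cdot\nu_2(\bar y)\in D(M)$ and $\nu_1,\nu_2$ agree outside $\bar y$; $\cup,\cap,\setminus$ and $;$ are the set operations and relational composition; $(\nu_1,\nu_2)\in\mathrm{cyl}^l_Z(A)$ iff $(\nu_1',\nu_2)\in A$ for some $\nu_1'$ that agrees with $\nu_1$ outside $Z$, and $\mathrm{cyl}^r_Z$ is the same on the right-hand side; $\sigma^{lr}_{x=y}$, $\sigma^{l}_{x=y}$, $\sigma^{r}_{x=y}$ keep the pairs with $\nu_1(x)=\nu_2(y)$, $\nu_1(x)=\nu_1(y)$, $\nu_2(x)=\nu_2(y)$, respectively. The set $O^{\mathrm{sem}}(\alpha)$ of semantic outputs consists of the variables $x$ for which there are $D$ and $(\nu_1,\nu_2)\in[\![\alpha]\!]_D$ with $\nu_1(x)\ne\nu_2(x)$. A variable $x$ is a semantic input of $\alpha$ if $\mathbb V\setminus\{x\}$ does not determine $\alpha$ on $O^{\mathrm{sem}}(\alpha)$,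 i.e. if it is not the case that for all $D$, all $(\nu_1,\nu_2)\in[\![\alpha]\!]_D$ and all $\nu_1'$ that agree with $\nu_1$ on $\mathbb V\setminus\{x\}$ there is $\nu_2'$ that agrees with $\nu_2$ on $O^{\mathrm{sem}}(\alpha)$ and satisfies $(\nu_1',\nu_2')\in[\![\alpha]\!]_D$. **Proposition.** The semantic input membership problem is undecidable: no algorithm decides, given a variable $x\in\mathbb V$ and a LIF expression $\alpha$, whether $x$ is a semantic input of $\alpha$. This holds when $\alpha$ ranges over the LIF expressions over all vocabularies (that is, over a vocabulary with infinitely many module names for each pair of input and output arities), and also when $\alpha$ ranges over the LIF expressions over one suitable fixed finite vocabulary. -/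

import Mathlib

/-!
Logic of Information Flows (LIF): syntax, semantics as binary relations on valuations,
semantic inputs and outputs, and the decision problem of semantic input membership.
-/

namespace LIF

universe u v w

/-- A module vocabulary with module names `N`: every name has an arity and an input arity,
the latter being at most the former. -/
structure Vocabulary (N : Type u) where
  nonempty : Nonempty N
  ar : N → ℕ
  iar : N → ℕ
  iar_le : ∀ M, iar M ≤ ar M

/-- An interpretation assigns to each module name a relation of the right arity over `dom`. -/
abbrev Interpretation {N : Type u} (S : Vocabulary N) (dom : Type w) : Type (max u w) :=
  (M : N) → Set (Fin (S.ar M) → dom)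

/-- Valuations of the variables `V` in `dom`. -/
abbrev Valuation (V : Type v) (dom : Type w) : Type (max v w) := V → dom

/-- Binary relations on valuations. -/
abbrev BRV (V : Type v) (dom : Type w) : Type (max v w) :=
  Set (Valuation V dom × Valuation V dom)

namespace BRV

variable {V : Type v} {dom : Type w}

/-- The identity relation. -/
def ident : BRV V dom := {p | p.1 = p.2}

/-- Composition. -/
def comp (A B : BRV V dom) : BRV V dom := {p | ∃ ν, (p.1, ν) ∈ A ∧ (ν, p.2) ∈ B}

/-- Left cylindrification on the set of variables `Z`. -/
def cylL (Z : Set V) (A : BRV V dom) : BRV V dom :=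
  {p | ∃ ν, (ν, p.2) ∈ A ∧ Set.EqOn ν p.1 Zᶜ}

/-- Right cylindrification on the set of variables `Z`. -/
def cylR (Z : Set V) (A : BRV V dom) : BRV V dom :=
  {p | ∃ ν, (p.1, ν) ∈ A ∧ Set.EqOn ν p.2 Zᶜ}

/-- Left selection. -/
def selL (x y : V) (A : BRV V dom) : BRV V dom := {p | p ∈ A ∧ p.1 x = p.1 y}

/-- Right selection. -/
def selR (x y : V) (A : BRV V dom) : BRV V dom := {p | p ∈ A ∧ p.2 x = p.2 y}

/-- Left-to-right selection. -/
def selLR (x y : V) (A : BRV V dom) : BRV V dom := {p | p ∈ A ∧ p.1 x = p.2 y}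

end BRV

/-- LIF expressions over the vocabulary `S` with variables from `V`. In `atom M z`, the first
`S.iar M` entries of the tuple `z` are the input arguments, the other ones the output arguments. -/
inductive Expr {N : Type u} (S : Vocabulary N) (V : Type v) : Type (max u v)
  | ident : Expr S V
  | atom (M : N) (z : Fin (S.ar M) → V) : Expr S V
  | union (a b : Expr S V) : Expr S V
  | inter (a b : Expr S V) : Expr S V
  | diff (a b : Expr S V) : Expr S V
  | comp (a b : Expr S V) : Expr S V
  | cylL (Z : Finset V) (a : Expr S V) : Expr S V
  | cylR (Z : Finset V) (a : Expr S V) : Expr S V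
  | selLR (x y : V) (a : Expr S V) : Expr S V
  | selL (x y : V) (a : Expr S V) : Expr S V
  | selR (x y : V) (a : Expr S V) : Expr S V

/-- Semantics of an atomic module expression: the inputs are read in the left valuation, the
outputs in the right one, and the two valuations agree outside the output variables. -/
def atomSem {N : Type u} {S : Vocabulary N} {V : Type v} {dom : Type w}
    (D : Interpretation S dom) (M : N) (z : Fin (S.ar M) → V) : BRV V dom :=
  {p | (fun i : Fin (S.ar M) => if (i : ℕ) < S.iar M then p.1 (z i) else p.2 (z i)) ∈ D M ∧
    Set.EqOn p.1 p.2 {y | ∃ i : Fin (S.ar M), S.iar M ≤ (i : ℕ) ∧ z i = y}ᶜ}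

/-- A global BRV maps interpretations to binary relations on valuations. -/
abbrev GlobalBRV {N : Type u} (S : Vocabulary N) (V : Type v) (dom : Type w) :
    Type (max u v w) :=
  Interpretation S dom → BRV V dom

/-- The global BRV denoted by an expression. -/
def Expr.sem {N : Type u} {S : Vocabulary N} {V : Type v} (dom : Type w) :
    Expr S V → GlobalBRV S V dom
  | .ident, _ => BRV.ident
  | .atom M z, D => atomSem D M z
  | .union a b, D => a.sem dom D ∪ b.sem dom D
  | .inter a b, D => a.sem dom D ∩ b.sem dom D
  | .diff a b, D => a.sem dom D \ b.sem dom D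
  | .comp a b, D => BRV.comp (a.sem dom D) (b.sem dom D)
  | .cylL Z a, D => BRV.cylL (Z : Set V) (a.sem dom D)
  | .cylR Z a, D => BRV.cylR (Z : Set V) (a.sem dom D)
  | .selLR x y a, D => BRV.selLR x y (a.sem dom D)
  | .selL x y a, D => BRV.selL x y (a.sem dom D)
  | .selR x y a, D => BRV.selR x y (a.sem dom D)

section Global

variable {N : Type u} {S : Vocabulary N} {V : Type v} {dom : Type w}

/-- The semantic outputs of a global BRV. -/
def GlobalBRV.semOutputs (Q : GlobalBRV S V dom) : Set V :=
  {x | ∃ D : Interpretation S dom, ∃ p ∈ Q D, p.1 x ≠ p.2 x}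

/-- `X` determines `Q` on `Y`. -/
def GlobalBRV.Determines (Q : GlobalBRV S V dom) (X Y : Set V) : Prop :=
  ∀ (D : Interpretation S dom) (ν₁ ν₂ : Valuation V dom), (ν₁, ν₂) ∈ Q D →
    ∀ ν₁' : Valuation V dom, Set.EqOn ν₁' ν₁ X →
      ∃ ν₂' : Valuation V dom, Set.EqOn ν₂' ν₂ Y ∧ (ν₁', ν₂') ∈ Q D

/-- The semantic inputs of a global BRV: the variables `x` such that the set of all other
variables does not determine `Q` on its semantic outputs. -/
def GlobalBRV.semInputs (Q : GlobalBRV S V dom) : Set V :=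
  {x | ¬ GlobalBRV.Determines Q {x}ᶜ (GlobalBRV.semOutputs Q)}

end Global

/-- The semantic inputs of a LIF expression. -/
def Expr.semInputs {N : Type u} {S : Vocabulary N} {V : Type v} (dom : Type w)
    (a : Expr S V) : Set V :=
  GlobalBRV.semInputs (a.sem dom)

/-- Gödel numbering of LIF expressions: a constructor tag paired with the codes of the
arguments. -/
def Expr.code {N : Type u} [Encodable N] {S : Vocabulary N} {V : Type v} [Encodable V] :
    Expr S V → ℕ
  | .ident => Nat.pair 0 0
  | .atom M z => Nat.pair 1 (Nat.pair (Encodable.encode M) (Encodable.encode (List.ofFn z)))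
  | .union a b => Nat.pair 2 (Nat.pair a.code b.code)
  | .inter a b => Nat.pair 3 (Nat.pair a.code b.code)
  | .diff a b => Nat.pair 4 (Nat.pair a.code b.code)
  | .comp a b => Nat.pair 5 (Nat.pair a.code b.code)
  | .cylL Z a => Nat.pair 6 (Nat.pair (Encodable.encode Z) a.code)
  | .cylR Z a => Nat.pair 7 (Nat.pair (Encodable.encode Z) a.code)
  | .selLR x y a =>
      Nat.pair 8 (Nat.pair (Encodable.encode x) (Nat.pair (Encodable.encode y) a.code))
  | .selL x y a =>
      Nat.pair 9 (Nat.pair (Encodable.encode x) (Nat.pair (Encodable.encode y) a.code))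
  | .selR x y a =>
      Nat.pair 10 (Nat.pair (Encodable.encode x) (Nat.pair (Encodable.encode y) a.code))

/-- The Gödel numbering is faithful. -/
theorem Expr.code_injective {N : Type u} [Encodable N] {S : Vocabulary N} {V : Type v}
    [Encodable V] : Function.Injective (Expr.code (S := S) (V := V)) := by
  intro a
  induction a with
  | ident => intro b h; cases b <;> simp_all [Expr.code, Nat.pair_eq_pair]
  | atom M z =>
    intro b h
    cases b with
    | atom M' z' =>
      simp only [Expr.code, Nat.pair_eq_pair, true_and, Encodable.encode_inj] at h
      obtain ⟨rfl, h⟩ := h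
      rw [List.ofFn_injective h]
    | _ => simp [Expr.code, Nat.pair_eq_pair] at h
  | union a b iha ihb | inter a b iha ihb | diff a b iha ihb | comp a b iha ihb =>
    intro c h
    cases c <;> simp [Expr.code, Nat.pair_eq_pair] at h
    rw [iha h.1, ihb h.2]
  | cylL Z a ih | cylR Z a ih =>
    intro c h
    cases c <;> simp [Expr.code, Nat.pair_eq_pair] at h
    rw [h.1, ih h.2]
  | selLR x y a ih | selL x y a ih | selR x y a ih =>
    intro c h
    cases c <;> simp [Expr.code, Nat.pair_eq_pair] at h
    rw [h.1, h.2.1, ih h.2.2]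

/-- The semantic input membership problem over `S` is decidable: some computable predicate on
natural numbers decides, from the code of a variable `x` and a LIF expression `a`, whether
`x` is a semantic input of `a`. -/
def SemanticInputMembershipDecidable {N : Type u} [Encodable N] (S : Vocabulary N)
    (V : Type v) [Encodable V] (dom : Type w) : Prop :=
  ∃ P : ℕ → Prop, ComputablePred P ∧
    ∀ (x : V) (a : Expr S V),
      P (Nat.pair (Encodable.encode x) a.code) ↔ x ∈ a.semInputs dom

/-- The vocabulary that has, for all `i` and `o`, infinitely many module names `(k, i, o)` with
`i` input and `o` output arguments. Up to renaming of the module names, the expressions over it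
are the expressions over all vocabularies. -/
def universalVocabulary : Vocabulary (ℕ × ℕ × ℕ) where
  nonempty := ⟨(0, 0, 0)⟩
  ar M := M.2.1 + M.2.2
  iar M := M.2.1
  iar_le _ := Nat.le_add_right _ _

end LIF

namespace LIF

universe u v w

/-! ### Terms over binary relations -/

/-! With one variable `x` and modules of one input and one output, LIF expressions interpret
relation terms: a module is an arbitrary binary relation on `dom`, and `cylL {x} ident` is the full
relation in the coordinate `x` (`mem_sem_toExpr`). So undecidability reduces to that of
satisfiability of relation terms on a countably infinite set.

Fix a code `c` with undecidable halting problem. The term `diverges c n` is a test for the empty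
list, cut down to the empty relation as soon as one of finitely many inclusions fails or the term
simulating `c` on `n` is nonempty. If `c` halts on `n`, no relations satisfy it: any model of the
inclusions with a `nil` point contains an image of the lists of numbers, possibly not injective and
beside other points, and the halting computation can be replayed there (`Represents.graph`). Replay
is sound because `graph c` is built without difference. If `c` diverges, the relations `listRel`,
transported along `dom ≃ List ℕ`, satisfy the term at exactly one point.

A partial identity that holds at some point but not everywhere has `x` as a semantic input: moving
`x` to a failing point leaves no partner valuation. The empty relation has no semantic inputs. Since
`c` is fixed, only the number of increments in `diverges c n` varies, so the reduction is primitive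
recursive and nine modules suffice. -/

/-- Relation terms over the relation symbols `ι`. -/
inductive RelTerm (ι : Type u) : Type u
  | one : RelTerm ι
  | top : RelTerm ι
  | sym (i : ι) : RelTerm ι
  | union (s t : RelTerm ι) : RelTerm ι
  | inter (s t : RelTerm ι) : RelTerm ι
  | diff (s t : RelTerm ι) : RelTerm ι
  | comp (s t : RelTerm ι) : RelTerm ι

namespace RelTerm

variable {ι : Type u} {A : Type v} {B : Type w}

/-- The binary relation denoted by a relation term. -/
@[simp]
def rel (r : ι → A → A → Prop) : RelTerm ι → A → A → Prop
  | one, a, b => a = b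
  | top, _, _ => True
  | sym i, a, b => r i a b
  | union s t, a, b => s.rel r a b ∨ t.rel r a b
  | inter s t, a, b => s.rel r a b ∧ t.rel r a b
  | diff s t, a, b => s.rel r a b ∧ ¬ t.rel r a b
  | comp s t, a, b => ∃ c, s.rel r a c ∧ t.rel r c b

theorem rel_equiv (e : A ≃ B) (r : ι → B → B → Prop) (t : RelTerm ι) (a b : A) :
    t.rel (fun i x y => r i (e x) (e y)) a b ↔ t.rel r (e a) (e b) := by
  induction t generalizing a b with
  | comp s t hs ht =>
    simp only [rel, hs, ht]
    exact ⟨fun ⟨c, h⟩ => ⟨e c, h⟩, fun ⟨c, h⟩ => ⟨e.symm c, by simpa using h⟩⟩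
  | _ => simp_all

/-- The term that is nonempty if and only if one of the given inclusions fails. -/
def violation : List (RelTerm ι × RelTerm ι) → RelTerm ι
  | [] => diff one one
  | p :: l => union (diff p.1 p.2) (violation l)

theorem rel_violation (r : ι → A → A → Prop) (l : List (RelTerm ι × RelTerm ι)) (a b : A) :
    (violation l).rel r a b ↔ ∃ p ∈ l, p.1.rel r a b ∧ ¬ p.2.rel r a b := by
  induction l with
  | nil => simp [violation]
  | cons p l ih => simp [violation, ih]

/-- All inclusions in the list hold. -/
def Satisfies (r : ι → A → A → Prop) (l : List (RelTerm ι × RelTerm ι)) : Prop :=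
  ∀ p ∈ l, ∀ a b, p.1.rel r a b → p.2.rel r a b

section ToExpr

variable {N : Type u} {S : Vocabulary N} {V : Type v} {dom : Type w} {κ : Type*}

/-- Relation terms as LIF expressions that use a single variable. -/
def toExpr (S : Vocabulary N) (x : V) (ρ : κ → N) : RelTerm κ → Expr S V
  | one => .ident
  | top => .cylL {x} .ident
  | sym i => .atom (ρ i) fun _ => x
  | union s t => .union (s.toExpr S x ρ) (t.toExpr S x ρ)
  | inter s t => .inter (s.toExpr S x ρ) (t.toExpr S x ρ)
  | diff s t => .diff (s.toExpr S x ρ) (t.toExpr S x ρ)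
  | comp s t => .comp (s.toExpr S x ρ) (t.toExpr S x ρ)

/-- The relations that an interpretation assigns to binary module names. -/
def ofInterpretation (ρ : κ → N) (D : Interpretation S dom) (i : κ) (a b : dom) : Prop :=
  (fun j : Fin (S.ar (ρ i)) => if (j : ℕ) < 1 then a else b) ∈ D (ρ i)

/-- An interpretation that assigns given relations to binary module names. -/
def toInterpretation (S : Vocabulary N) (ρ : κ → N) (r : κ → dom → dom → Prop) :
    Interpretation S dom :=
  fun M => {t | ∃ i a b, ρ i = M ∧ r i a b ∧ t = fun j : Fin (S.ar M) => if (j : ℕ) < 1 then a else b}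

theorem ofInterpretation_toInterpretation {ρ : κ → N} (hρ : Function.Injective ρ)
    (har : ∀ i, S.ar (ρ i) = 2) (r : κ → dom → dom → Prop) :
    ofInterpretation ρ (toInterpretation S ρ r) = r := by
  funext i a b
  simp only [ofInterpretation, toInterpretation, Set.mem_ofPred_eq, eq_iff_iff]
  constructor
  · rintro ⟨j, a', b', hj, h, he⟩
    obtain rfl := hρ hj
    have h0 := congrFun he ⟨0, by rw [har]; norm_num⟩
    have h1 := congrFun he ⟨1, by rw [har]; norm_num⟩
    simp only [zero_lt_one, lt_irrefl, if_true, if_false] at h0 h1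
    rwa [h0, h1]
  · exact fun h => ⟨i, a, b, rfl, h, rfl⟩

theorem mem_sem_toExpr {ρ : κ → N} (har : ∀ i, S.ar (ρ i) = 2) (hiar : ∀ i, S.iar (ρ i) = 1)
    (D : Interpretation S dom) (x : V) (t : RelTerm κ) (ν₁ ν₂ : Valuation V dom) :
    (ν₁, ν₂) ∈ (t.toExpr S x ρ).sem dom D ↔
      t.rel (ofInterpretation ρ D) (ν₁ x) (ν₂ x) ∧ Set.EqOn ν₁ ν₂ {x}ᶜ := by
  classical
  induction t generalizing ν₁ ν₂ with
  | one =>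
    simp only [toExpr, Expr.sem, BRV.ident, Set.mem_ofPred_eq, rel]
    constructor
    · rintro rfl
      exact ⟨rfl, fun _ _ => rfl⟩
    · rintro ⟨h, h'⟩
      funext y
      by_cases hy : y = x
      · rw [hy, h]
      · exact h' hy
  | top =>
    simp only [toExpr, Expr.sem, BRV.ident, BRV.cylL, Set.mem_ofPred_eq, rel, true_and]
    constructor
    · rintro ⟨ν, rfl, h⟩
      simpa using h.symm
    · exact fun h => ⟨ν₂, rfl, by simpa using h.symm⟩
  | sym i =>
    have : {y | ∃ j : Fin (S.ar (ρ i)), S.iar (ρ i) ≤ (j : ℕ) ∧ x = y} = {x} := by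
      ext y
      simp only [Set.mem_ofPred_eq, Set.mem_singleton_iff]
      constructor
      · rintro ⟨_, _, rfl⟩
        rfl
      · rintro rfl
        exact ⟨⟨1, by rw [har]; norm_num⟩, by rw [hiar], rfl⟩
    simp only [toExpr, Expr.sem, atomSem, this]
    simp only [Set.mem_ofPred_eq, rel, ofInterpretation, hiar]
  | union s t hs ht =>
    simp only [toExpr, Expr.sem, Set.mem_union, hs, ht, rel]
    tauto
  | inter s t hs ht =>
    simp only [toExpr, Expr.sem, Set.mem_inter_iff, hs, ht, rel]
    tauto
  | diff s t hs ht =>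
    simp only [toExpr, Expr.sem, Set.mem_sdiff, hs, ht, rel]
    tauto
  | comp s t hs ht =>
    simp only [toExpr, Expr.sem, BRV.comp, Set.mem_ofPred_eq, hs, ht, rel]
    constructor
    · rintro ⟨ν, ⟨h₁, e₁⟩, h₂, e₂⟩
      exact ⟨⟨ν x, h₁, h₂⟩, e₁.trans e₂⟩
    · rintro ⟨⟨c, h₁, h₂⟩, e⟩
      -- The intermediate valuation can differ from the outer ones only at `x`, so a midpoint in
      -- `dom` and a midpoint valuation are the same data.
      refine ⟨Function.update ν₁ x c, ⟨by simpa using h₁, fun y hy => ?_⟩,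
        by simpa using h₂, fun y hy => ?_⟩
      · rw [Function.update_of_ne hy]
      · rw [Function.update_of_ne hy, e hy]

/-- For a term below the identity that holds at no more than one point in some nonempty model,
the variable is a semantic input if and only if the term is satisfiable. -/
theorem mem_semInputs_toExpr_iff {ρ : κ → N} (har : ∀ i, S.ar (ρ i) = 2)
    (hiar : ∀ i, S.iar (ρ i) = 1) (x : V) (t : RelTerm κ)
    (hid : ∀ (r : κ → dom → dom → Prop) a b, t.rel r a b → a = b)
    (hsat : ∀ (r : κ → dom → dom → Prop) a b, t.rel r a b →
      ∃ D : Interpretation S dom, (∃ a, t.rel (ofInterpretation ρ D) a a) ∧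
        ∃ a, ¬ t.rel (ofInterpretation ρ D) a a) :
    x ∈ (t.toExpr S x ρ).semInputs dom ↔ ∃ (r : κ → dom → dom → Prop) (a b : dom), t.rel r a b := by
  classical
  simp only [Expr.semInputs, GlobalBRV.semInputs, Set.mem_ofPred_eq]
  constructor
  · intro h
    by_contra! hc
    refine h fun D ν₁ ν₂ hν => ?_
    rw [mem_sem_toExpr har hiar] at hν
    exact absurd hν.1 (hc _ _ _)
  · rintro ⟨r, a, b, hr⟩ hdet
    obtain ⟨D, ⟨a, ha⟩, a', ha'⟩ := hsat r a b hr
    -- Start from the loop at `a` and move `x` to the failing point `a'`. A partner valuation would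
    -- give a pair starting at `a'`, which `hid` turns into a loop at `a'`.
    obtain ⟨ν, -, hν⟩ := hdet D (fun _ => a) (fun _ => a)
      ((mem_sem_toExpr har hiar D x t _ _).2 ⟨ha, fun _ _ => rfl⟩)
      (Function.update (fun _ => a) x a') (fun y hy => by rw [Function.update_of_ne hy])
    have h := ((mem_sem_toExpr har hiar D x t _ _).1 hν).1
    rw [← hid _ _ _ h] at h
    simp only [Function.update_self] at h
    exact ha' h

end ToExpr

end RelTerm

/-! ### Lists of numbers and computations on them -/

/-- Relation symbols for an algebra of lists of natural numbers, with a symbol for the loops of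
`Turing.ToPartrec.Code`. -/
inductive ListSym
  | nil | push | unpush | incr | decr | tail | sameHead | prepend | loop

open RelTerm Turing.ToPartrec

namespace ListSym

/-- An enumeration of the symbols. -/
def idx : ListSym → Fin 9
  | nil => 0 | push => 1 | unpush => 2 | incr => 3 | decr => 4 | tail => 5 | sameHead => 6
  | prepend => 7 | loop => 8

theorem idx_injective : Function.Injective idx := by
  intro a b h
  cases a <;> cases b <;> first | rfl | exact absurd h (by decide)

end ListSym

/-- An injective numbering of codes. -/
def tag : Code → ℕ
  | .zero' => Nat.pair 0 0
  | .succ => Nat.pair 1 0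
  | .tail => Nat.pair 2 0
  | .cons f g => Nat.pair 3 (Nat.pair (tag f) (tag g))
  | .comp f g => Nat.pair 4 (Nat.pair (tag f) (tag g))
  | .case f g => Nat.pair 5 (Nat.pair (tag f) (tag g))
  | .fix f => Nat.pair 6 (tag f)

/-- One symbol `loop` serves all loops, with the tag of the body stored as the head of its input;
injectivity keeps different bodies apart in `listRel`. -/
theorem tag_injective : Function.Injective tag := by
  intro a
  induction a with
  | zero' | succ | tail => intro b h; cases b <;> simp_all [tag, Nat.pair_eq_pair]
  | cons f g hf hg | comp f g hf hg | case f g hf hg =>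
    intro b h
    cases b <;> simp [tag, Nat.pair_eq_pair] at h
    rw [hf h.1, hg h.2]
  | fix f hf =>
    intro b h
    cases b <;> simp [tag, Nat.pair_eq_pair] at h
    rw [hf h]

theorem mem_eval_cons {f g : Code} {v w : List ℕ} :
    w ∈ (Code.cons f g).eval v ↔
      ∃ a ∈ f.eval v, ∃ b ∈ g.eval v, w = a.headI :: b := by
  simp

theorem mem_eval_comp {f g : Code} {v w : List ℕ} :
    w ∈ (Code.comp f g).eval v ↔ ∃ a ∈ g.eval v, w ∈ f.eval a := by
  rw [Code.comp_eval]
  exact Part.mem_bind_iff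

theorem mem_eval_fix {f : Code} {v w : List ℕ} :
    w ∈ (Code.fix f).eval v ↔ ∃ a ∈ f.eval v,
      a.headI = 0 ∧ w = a.tail ∨ a.headI ≠ 0 ∧ w ∈ (Code.fix f).eval a.tail := by
  rw [Code.fix_eval]
  refine PFun.mem_fix_iff.trans ⟨?_, ?_⟩
  · rintro (h | ⟨b, h, hb⟩) <;> obtain ⟨a, ha, h⟩ := (Part.mem_map_iff _).1 h
    · refine ⟨a, ha, ?_⟩
      split_ifs at h with h0
      exact Or.inl ⟨h0, (Sum.inl.inj h).symm⟩
    · refine ⟨a, ha, ?_⟩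
      split_ifs at h with h0
      obtain rfl := Sum.inr.inj h
      exact Or.inr ⟨h0, hb⟩
  · rintro ⟨a, ha, ⟨h0, rfl⟩ | ⟨h0, h⟩⟩
    · exact Or.inl ((Part.mem_map_iff _).2 ⟨a, ha, by simp [h0]⟩)
    · exact Or.inr ⟨a.tail, (Part.mem_map_iff _).2 ⟨a, ha, by simp [h0]⟩, h⟩

/-- The intended meaning of the symbols. -/
def listRel : ListSym → List ℕ → List ℕ → Prop
  | .nil, a, b => a = [] ∧ b = []
  | .push, a, b => b = 0 :: a
  | .unpush, a, b => a = 0 :: b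
  | .incr, a, b => ∃ n u, a = n :: u ∧ b = (n + 1) :: u
  | .decr, a, b => ∃ n u, b = n :: u ∧ a = (n + 1) :: u
  | .tail, a, b => b = a.tail
  | .sameHead, a, b => a.headI = b.headI
  | .prepend, a, b => ∃ n, b = n :: a
  | .loop, a, b => ∃ f v, a = tag f :: v ∧ b ∈ (Code.fix f).eval v

/-- The test for the empty list. -/
def nilTest : RelTerm ListSym := inter (sym .nil) one

/-- Prefixing a term with increments. -/
def incrs (n : ℕ) (t : RelTerm ListSym) : RelTerm ListSym := (comp (sym .incr))^[n] t

theorem incrs_succ (n : ℕ) (t : RelTerm ListSym) :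
    incrs (n + 1) t = comp (sym .incr) (incrs n t) := Function.iterate_succ_apply' _ _ _

/-- The term that removes a zero head from a list, and keeps the empty list. -/
def zeroBranch : RelTerm ListSym := union nilTest (sym .unpush)

/-- The term for the loop with body `f`. -/
def loopTerm (f : Code) : RelTerm ListSym := comp (sym .push) (incrs (tag f) (sym .loop))

/-- The term for the graph of the evaluation of a code. -/
def graph : Code → RelTerm ListSym
  | .zero' => sym .push
  | .succ => inter (comp (sym .sameHead) (sym .incr)) (comp top (comp nilTest (sym .prepend)))
  | .tail => sym .tail
  | .cons f g => inter (comp (graph f) (sym .sameHead)) (comp (graph g) (sym .prepend))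
  | .comp f g => comp (graph g) (graph f)
  | .case f g => union (comp zeroBranch (graph f)) (comp (sym .decr) (graph g))
  | .fix f => loopTerm f

/-- Axioms for lists of natural numbers. -/
def listAxioms : List (RelTerm ListSym × RelTerm ListSym) :=
  [(one, comp (sym .push) (sym .unpush)),
    (inter one (comp top (union (sym .push) (sym .incr))), comp (sym .incr) (sym .decr)),
    (nilTest, sym .tail),
    (sym .unpush, sym .tail),
    (comp (sym .decr) (sym .tail), sym .tail),
    (comp nilTest (comp top (sym .push)), sym .sameHead),
    (comp (sym .unpush) (comp top (sym .push)), sym .sameHead),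
    (comp (sym .decr) (comp (sym .sameHead) (sym .incr)), sym .sameHead),
    (sym .push, sym .prepend),
    (comp (sym .prepend) (sym .incr), sym .prepend)]

/-- Axioms for the loops in a code. -/
def loopAxioms : Code → List (RelTerm ListSym × RelTerm ListSym)
  | .zero' => []
  | .succ => []
  | .tail => []
  | .cons f g => loopAxioms f ++ loopAxioms g
  | .comp f g => loopAxioms f ++ loopAxioms g
  | .case f g => loopAxioms f ++ loopAxioms g
  | .fix f =>
    (comp (graph f) zeroBranch, loopTerm f) ::
      (comp (graph f) (comp (sym .decr) (comp (sym .tail) (loopTerm f))), loopTerm f) ::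
        loopAxioms f

theorem rel_nilTest (a b : List ℕ) : nilTest.rel listRel a b ↔ a = [] ∧ b = [] := by
  simp only [nilTest, rel, listRel]
  constructor
  · exact fun h => h.1
  · rintro ⟨rfl, rfl⟩
    simp

theorem rel_incrs (n k : ℕ) (u b : List ℕ) (t : RelTerm ListSym) :
    (incrs n t).rel listRel (k :: u) b ↔ t.rel listRel ((k + n) :: u) b := by
  induction n generalizing k with
  | zero => rfl
  | succ n ih =>
    rw [incrs_succ]
    simp only [rel, listRel]
    constructor
    · rintro ⟨c, ⟨m, w, h, rfl⟩, hc⟩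
      obtain ⟨rfl, rfl⟩ := List.cons.inj h
      rwa [ih, Nat.add_right_comm] at hc
    · exact fun h => ⟨_, ⟨k, u, rfl, rfl⟩, by rwa [ih, Nat.add_right_comm]⟩

theorem rel_zeroBranch (a b : List ℕ) :
    zeroBranch.rel listRel a b ↔ a.headI = 0 ∧ b = a.tail := by
  simp only [zeroBranch, rel, rel_nilTest, listRel]
  rcases a with _ | ⟨n, u⟩
  · simp
  · simp [eq_comm (a := u)]

theorem rel_loopTerm (f : Code) (a b : List ℕ) :
    (loopTerm f).rel listRel a b ↔ b ∈ (Code.fix f).eval a := by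
  simp only [loopTerm, rel, listRel, exists_eq_left, rel_incrs, Nat.zero_add]
  constructor
  · rintro ⟨g, v, h, hb⟩
    obtain ⟨hg, rfl⟩ := List.cons.inj h
    rwa [tag_injective hg]
  · exact fun h => ⟨f, a, rfl, h⟩

theorem rel_graph (c : Code) (a b : List ℕ) : (graph c).rel listRel a b ↔ b ∈ c.eval a := by
  induction c generalizing a b with
  | zero' => simp [graph, listRel]
  | succ =>
    simp only [graph, rel, rel_nilTest, listRel, Code.succ_eval]
    constructor
    -- `sameHead` followed by `incr` fixes only the head of the output; the second conjunct, a
    -- `prepend` to the empty list, makes its tail empty.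
    · rintro ⟨⟨_, h, n, u, rfl, rfl⟩, _, -, _, ⟨-, rfl⟩, m, hm⟩
      simp_all
    · intro h
      obtain rfl : b = [a.headI.succ] := by simpa using h
      exact ⟨⟨[a.headI], rfl, _, _, rfl, rfl⟩, [], trivial, [], ⟨rfl, rfl⟩, _, rfl⟩
  | tail => simp [graph, listRel]
  | cons f g hf hg =>
    rw [mem_eval_cons]
    simp only [graph, rel, hf, hg, listRel]
    constructor
    · rintro ⟨⟨u, hu, h⟩, w, hw, n, rfl⟩
      exact ⟨u, hu, w, hw, by rw [h]; rfl⟩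
    · rintro ⟨u, hu, w, hw, rfl⟩
      exact ⟨⟨u, hu, rfl⟩, w, hw, _, rfl⟩
  | comp f g hf hg => simp only [mem_eval_comp, graph, rel, hf, hg]
  | case f g hf hg =>
    simp only [graph, rel, hf, hg, rel_zeroBranch, listRel, Code.case_eval]
    rcases a with _ | ⟨_ | n, u⟩ <;> simp
  | fix f hf => exact rel_loopTerm f a b

theorem satisfies_listAxioms : Satisfies listRel listAxioms := by
  simp only [Satisfies, listAxioms, List.forall_mem_cons, rel, rel_nilTest, listRel]
  refine ⟨?_, ?_, ?_, ?_, ?_, ?_, ?_, ?_, ?_, ?_, by simp⟩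
  · rintro a _ rfl
    exact ⟨_, rfl, rfl⟩
  · rintro a _ ⟨rfl, c, -, rfl | ⟨n, u, rfl, rfl⟩⟩
    · exact ⟨_, ⟨_, _, rfl, rfl⟩, _, _, rfl, rfl⟩
    · exact ⟨_, ⟨_, _, rfl, rfl⟩, _, _, rfl, rfl⟩
  · rintro _ _ ⟨rfl, rfl⟩
    rfl
  · rintro _ b rfl
    rfl
  · rintro _ _ ⟨_, ⟨n, u, rfl, rfl⟩, rfl⟩
    rfl
  · rintro _ _ ⟨_, ⟨rfl, rfl⟩, c, -, rfl⟩
    rfl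
  · rintro _ _ ⟨_, rfl, c, -, rfl⟩
    rfl
  · rintro _ _ ⟨_, ⟨n, u, rfl, rfl⟩, _, h, m, w, rfl, rfl⟩
    simpa using h
  · rintro a _ rfl
    exact ⟨_, rfl⟩
  · rintro a _ ⟨_, ⟨n, rfl⟩, m, u, h, rfl⟩
    obtain ⟨rfl, rfl⟩ := List.cons.inj h
    exact ⟨_, rfl⟩

theorem satisfies_loopAxioms (c : Code) : Satisfies listRel (loopAxioms c) := by
  induction c with
  | zero' | succ | tail => simp [Satisfies, loopAxioms]
  | cons f g hf hg | comp f g hf hg | case f g hf hg =>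
    intro p hp
    rcases List.mem_append.1 hp with h | h
    · exact hf p h
    · exact hg p h
  | fix f hf =>
    simp only [Satisfies, loopAxioms, List.forall_mem_cons]
    refine ⟨fun a b h => ?_, fun a b h => ?_, hf⟩
    · simp only [rel, rel_graph, rel_zeroBranch] at h
      obtain ⟨c, hc, h⟩ := h
      exact (rel_loopTerm f a b).2 (mem_eval_fix.2 ⟨c, hc, Or.inl h⟩)
    · simp only [rel, rel_graph, rel_loopTerm, listRel] at h
      obtain ⟨_, hc, _, ⟨n, u, rfl, rfl⟩, _, rfl, h⟩ := h
      exact (rel_loopTerm f a b).2 (mem_eval_fix.2 ⟨_, hc, Or.inr ⟨by simp, h⟩⟩)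

/-! ### Arbitrary models of the axioms -/

section Model

variable {A : Type u} {r : ListSym → A → A → Prop}

/-- `val` represents lists of natural numbers in a model. -/
structure Represents (r : ListSym → A → A → Prop) (val : List ℕ → A) : Prop where
  nil : r .nil (val []) (val [])
  push : ∀ v, r .push (val v) (val (0 :: v))
  unpush : ∀ v, r .unpush (val (0 :: v)) (val v)
  incr : ∀ n v, r .incr (val (n :: v)) (val ((n + 1) :: v))
  decr : ∀ n v, r .decr (val ((n + 1) :: v)) (val (n :: v))

/-- The first two axioms provide a pushed zero at every point and an increment at every point
reached by `push` or `incr`, each with its inverse step. Choosing these and folding over a list from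
`e` gives `val`. -/
theorem exists_represents (h : Satisfies r listAxioms) {e : A} (he : r .nil e e) :
    ∃ val : List ℕ → A, Represents r val := by
  simp only [Satisfies, listAxioms, List.forall_mem_cons, rel] at h
  obtain ⟨h₁, h₂, -⟩ := h
  have h₁ : ∀ a, ∃ b, r .push a b ∧ r .unpush b a := fun a => h₁ a a rfl
  have h₂ : ∀ a, ∃ b, (∃ c, r .push c a ∨ r .incr c a) → r .incr a b ∧ r .decr b a := by
    intro a
    by_cases hc : ∃ c, r .push c a ∨ r .incr c a
    · obtain ⟨c, hc⟩ := hc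
      obtain ⟨b, hb⟩ := h₂ a a ⟨rfl, c, trivial, hc⟩
      exact ⟨b, fun _ => hb⟩
    -- A dummy value that makes the successor total: the axiom promises no increment here, just as
    -- the empty list has none in `listRel`.
    · exact ⟨a, fun h => absurd h hc⟩
  choose z hz using h₁
  choose s hs using h₂
  let val : List ℕ → A := fun l => l.foldr (fun n a => s^[n] (z a)) e
  have hsucc : ∀ n v, val ((n + 1) :: v) = s (val (n :: v)) := fun n v =>
    Function.iterate_succ_apply' _ _ _
  -- The guard of the increment axiom holds at every represented nonempty list.
  have key : ∀ n v, ∃ c, r .push c (val (n :: v)) ∨ r .incr c (val (n :: v)) := by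
    intro n v
    induction n with
    | zero => exact ⟨val v, Or.inl (hz _).1⟩
    | succ n ih => exact ⟨val (n :: v), Or.inr (by rw [hsucc]; exact (hs _ ih).1)⟩
  refine ⟨val, he, fun v => (hz _).1, fun v => (hz _).2, fun n v => ?_, fun n v => ?_⟩
  · rw [hsucc]
    exact (hs _ (key n v)).1
  · rw [hsucc]
    exact (hs _ (key n v)).2

namespace Represents

variable {val : List ℕ → A}

theorem nilTest (hv : Represents r val) : nilTest.rel r (val []) (val []) := ⟨hv.nil, rfl⟩

theorem tail (hv : Represents r val) (h : Satisfies r listAxioms) (v : List ℕ) :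
    r .tail (val v) (val v.tail) := by
  simp only [Satisfies, listAxioms, List.forall_mem_cons, rel] at h
  obtain ⟨-, -, h₁, h₂, h₃, -⟩ := h
  rcases v with _ | ⟨n, u⟩
  · exact h₁ _ _ hv.nilTest
  · induction n with
    | zero => exact h₂ _ _ (hv.unpush u)
    | succ n ih => exact h₃ _ _ ⟨_, hv.decr n u, ih⟩

theorem sameHead (hv : Represents r val) (h : Satisfies r listAxioms) (v u : List ℕ) :
    r .sameHead (val v) (val (v.headI :: u)) := by
  simp only [Satisfies, listAxioms, List.forall_mem_cons, rel] at h
  obtain ⟨-, -, -, -, -, h₁, h₂, h₃, -⟩ := h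
  rcases v with _ | ⟨n, w⟩
  · exact h₁ _ _ ⟨_, hv.nilTest, _, trivial, hv.push u⟩
  · induction n with
    | zero => exact h₂ _ _ ⟨_, hv.unpush w, _, trivial, hv.push u⟩
    | succ n ih => exact h₃ _ _ ⟨_, hv.decr n w, _, ih, hv.incr n u⟩

theorem prepend (hv : Represents r val) (h : Satisfies r listAxioms) (n : ℕ) (v : List ℕ) :
    r .prepend (val v) (val (n :: v)) := by
  simp only [Satisfies, listAxioms, List.forall_mem_cons, rel] at h
  obtain ⟨-, -, -, -, -, -, -, -, h₁, h₂, -⟩ := h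
  induction n with
  | zero => exact h₁ _ _ (hv.push v)
  | succ n ih => exact h₂ _ _ ⟨_, ih, hv.incr n v⟩

theorem zeroBranch (hv : Represents r val) {v : List ℕ} (h : v.headI = 0) :
    zeroBranch.rel r (val v) (val v.tail) := by
  rcases v with _ | ⟨_ | n, u⟩
  · exact Or.inl hv.nilTest
  · exact Or.inr (hv.unpush u)
  · simp at h

theorem incrs (hv : Represents r val) {n k : ℕ} {v : List ℕ} {b : A} {t : RelTerm ListSym}
    (h : t.rel r (val ((k + n) :: v)) b) : (incrs n t).rel r (val (k :: v)) b := by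
  induction n generalizing k with
  | zero => exact h
  | succ n ih =>
    rw [incrs_succ]
    exact ⟨_, hv.incr k v, ih (by rwa [Nat.add_right_comm])⟩

/-- Only this direction can be expected in an arbitrary model, where the symbols may hold of extra
pairs. For `fix` it suffices that `loop` is closed under the rules in `loopAxioms`: a terminating
loop is a finite chain of iterations, followed backwards from its last one. -/
theorem graph (hv : Represents r val) (h : Satisfies r listAxioms) {c : Code}
    (hc : Satisfies r (loopAxioms c)) {v w : List ℕ} (hw : w ∈ c.eval v) :
    (graph c).rel r (val v) (val w) := by
  induction c generalizing v w with
  | zero' =>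
    obtain rfl : w = 0 :: v := by simpa using hw
    exact hv.push v
  | succ =>
    obtain rfl : w = [v.headI.succ] := by simpa using hw
    exact ⟨⟨_, hv.sameHead h v [], hv.incr _ _⟩, val [], trivial, _, hv.nilTest,
      hv.prepend h _ _⟩
  | tail =>
    obtain rfl : w = v.tail := by simpa using hw
    exact hv.tail h v
  | cons f g hf hg =>
    obtain ⟨a, ha, b, hb, rfl⟩ := mem_eval_cons.1 hw
    exact ⟨⟨_, hf (fun p hp => hc p (List.mem_append_left _ hp)) ha, hv.sameHead h _ _⟩,
      _, hg (fun p hp => hc p (List.mem_append_right _ hp)) hb, hv.prepend h _ _⟩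
  | comp f g hf hg =>
    obtain ⟨a, ha, hw⟩ := mem_eval_comp.1 hw
    exact ⟨_, hg (fun p hp => hc p (List.mem_append_right _ hp)) ha,
      hf (fun p hp => hc p (List.mem_append_left _ hp)) hw⟩
  | case f g hf hg =>
    rw [Code.case_eval] at hw
    have hf := fun v w => @hf (fun p hp => hc p (List.mem_append_left _ hp)) v w
    have hg := fun v w => @hg (fun p hp => hc p (List.mem_append_right _ hp)) v w
    rcases v with _ | ⟨_ | n, u⟩
    · exact Or.inl ⟨_, hv.zeroBranch rfl, hf _ _ hw⟩
    · exact Or.inl ⟨_, hv.zeroBranch rfl, hf _ _ hw⟩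
    · exact Or.inr ⟨_, hv.decr n u, hg _ _ hw⟩
  | fix f hf =>
    simp only [Satisfies, loopAxioms, List.forall_mem_cons] at hc
    obtain ⟨h₁, h₂, hc⟩ := hc
    have hf := fun v w => @hf hc v w
    rw [Code.fix_eval] at hw
    refine PFun.fixInduction' (C := fun v => (loopTerm f).rel r (val v) (val w)) hw ?_ ?_
    · intro v hv'
      obtain ⟨a, ha, e⟩ := (Part.mem_map_iff _).1 hv'
      split_ifs at e with h0
      obtain rfl := Sum.inl.inj e
      exact h₁ _ _ ⟨_, hf _ _ ha, hv.zeroBranch h0⟩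
    · intro v u _ hu ih
      obtain ⟨a, ha, e⟩ := (Part.mem_map_iff _).1 hu
      split_ifs at e with h0
      obtain rfl := Sum.inr.inj e
      rcases a with _ | ⟨_ | n, a⟩
      · simp at h0
      · simp at h0
      -- The `decr` step witnesses that the head is nonzero; `tail` then drops that head before the
      -- next iteration.
      · exact h₂ _ _ ⟨_, hf _ _ ha, _, hv.decr n a, _, hv.tail h _, ih⟩

end Represents

end Model

/-! ### Halting as unsatisfiability -/

/-- The term for the computation of the code `c` on the input `n`. -/
def run (c : Code) (n : ℕ) : RelTerm ListSym :=
  comp nilTest (comp (sym .push) (incrs n (graph c)))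

/-- The test for the empty list if the axioms hold and `c` does not halt on `n`, and the empty
relation otherwise. -/
def diverges (c : Code) (n : ℕ) : RelTerm ListSym :=
  diff nilTest
    (comp top (comp (union (violation (listAxioms ++ loopAxioms c)) (run c n)) top))

/-- The factors `top` on both sides make the subtracted condition global: one bad pair anywhere
removes every point. -/
theorem rel_diverges {A : Type u} (r : ListSym → A → A → Prop) (c : Code) (n : ℕ) (a b : A) :
    (diverges c n).rel r a b ↔ (r .nil a b ∧ a = b) ∧
      Satisfies r (listAxioms ++ loopAxioms c) ∧ ∀ a b, ¬ (run c n).rel r a b := by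
  simp only [diverges, rel, rel_violation, nilTest, true_and, and_true, Satisfies]
  refine and_congr_right fun _ => ⟨fun h => ⟨fun p hp x y hxy => ?_, fun x y hxy => ?_⟩, ?_⟩
  · by_contra hn
    exact h ⟨x, y, Or.inl ⟨p, hp, hxy, hn⟩⟩
  · exact h ⟨x, y, Or.inr hxy⟩
  · rintro ⟨h₁, h₂⟩ ⟨x, y, ⟨p, hp, hxy, hn⟩ | hxy⟩
    · exact hn (h₁ p hp x y hxy)
    · exact h₂ x y hxy

theorem not_dom_of_rel_diverges {A : Type u} {r : ListSym → A → A → Prop} {c : Code} {n : ℕ}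
    {a b : A} (h : (diverges c n).rel r a b) : ¬ (c.eval [n]).Dom := by
  rw [rel_diverges] at h
  obtain ⟨⟨he, rfl⟩, hax, hrun⟩ := h
  intro hd
  obtain ⟨w, hw⟩ := Part.dom_iff_mem.1 hd
  have h₁ : Satisfies r listAxioms := fun p hp => hax p (List.mem_append_left _ hp)
  have h₂ : Satisfies r (loopAxioms c) := fun p hp => hax p (List.mem_append_right _ hp)
  obtain ⟨val, hv⟩ := exists_represents h₁ he
  -- The term `run` builds the input `[n]` from the empty list by pushing a zero and incrementing it
  -- `n` times.
  refine hrun (val []) (val w) ⟨_, hv.nilTest, _, hv.push [], hv.incrs ?_⟩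
  rw [Nat.zero_add]
  exact hv.graph h₁ h₂ hw

theorem rel_diverges_listRel {c : Code} {n : ℕ} (h : ¬ (c.eval [n]).Dom) (a b : List ℕ) :
    (diverges c n).rel listRel a b ↔ a = [] ∧ b = [] := by
  rw [rel_diverges, ← rel_nilTest]
  refine and_iff_left ⟨fun p hp => ?_, fun a b hab => ?_⟩
  · rcases List.mem_append.1 hp with hp | hp
    · exact satisfies_listAxioms p hp
    · exact satisfies_loopAxioms c p hp
  · simp only [run, rel, rel_nilTest, listRel] at hab
    obtain ⟨_, ⟨-, rfl⟩, _, rfl, hab⟩ := hab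
    rw [rel_incrs, Nat.zero_add, rel_graph] at hab
    exact h (Part.dom_iff_mem.2 ⟨_, hab⟩)

theorem mem_semInputs_diverges_iff {N : Type u} {S : Vocabulary N} {V : Type v} {dom : Type w}
    (e : dom ≃ List ℕ) {ρ : ListSym → N} (hρ : Function.Injective ρ)
    (har : ∀ i, S.ar (ρ i) = 2) (hiar : ∀ i, S.iar (ρ i) = 1) (x : V) (c : Code) (n : ℕ) :
    x ∈ ((diverges c n).toExpr S x ρ).semInputs dom ↔ ¬ (c.eval [n]).Dom := by
  have hstd : ¬ (c.eval [n]).Dom → ∀ a b : dom,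
      (diverges c n).rel (fun i x y => listRel i (e x) (e y)) a b ↔ e a = [] ∧ e b = [] :=
    fun h a b => by rw [rel_equiv, rel_diverges_listRel h]
  rw [mem_semInputs_toExpr_iff har hiar]
  · constructor
    · rintro ⟨r, a, b, h⟩
      exact not_dom_of_rel_diverges h
    · exact fun h => ⟨_, e.symm [], e.symm [], (hstd h _ _).2 (by simp)⟩
  · exact fun r a b h => ((rel_diverges r c n a b).1 h).1.2
  · intro r a b h
    have hd := not_dom_of_rel_diverges h
    refine ⟨toInterpretation S ρ fun i x y => listRel i (e x) (e y), ?_⟩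
    rw [ofInterpretation_toInterpretation hρ har]
    exact ⟨⟨e.symm [], (hstd hd _ _).2 (by simp)⟩, e.symm [0], fun h => by
      simpa using ((hstd hd _ _).1 h).1⟩

/-! ### Undecidability -/

theorem primrec_code_diverges {N : Type u} [Encodable N] {S : Vocabulary N} {V : Type v}
    [Encodable V] (x : V) (ρ : ListSym → N) (c : Code) :
    Primrec fun n => ((diverges c n).toExpr S x ρ).code := by
  -- Each increment wraps the code in the same numeric function, 5 being the constructor tag of
  -- `comp`; everything else in the code of `diverges c n` is constant in `n`.
  have key : ∀ n (t : RelTerm ListSym), ((incrs n t).toExpr S x ρ).code =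
      (fun k => Nat.pair 5 (Nat.pair (((sym .incr).toExpr S x ρ).code) k))^[n]
        (t.toExpr S x ρ).code := by
    intro n t
    induction n with
    | zero => rfl
    | succ n ih =>
      rw [incrs_succ, Function.iterate_succ_apply', ← ih]
      rfl
  have hpair : ∀ {f : ℕ → ℕ} (k : ℕ), Primrec f → Primrec fun n => Nat.pair k (f n) :=
    fun k hf => Primrec₂.natPair.comp (Primrec.const k) hf
  have hpair' : ∀ {f : ℕ → ℕ} (k : ℕ), Primrec f → Primrec fun n => Nat.pair (f n) k :=
    fun k hf => Primrec₂.natPair.comp hf (Primrec.const k)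
  have hincrs : Primrec fun n => ((incrs n (graph c)).toExpr S x ρ).code := by
    simp only [key]
    exact Primrec.nat_iterate Primrec.id (Primrec.const _)
      (Primrec₂.natPair.comp (Primrec.const 5)
        (Primrec₂.natPair.comp (Primrec.const _) Primrec.snd)).to₂
  simp only [diverges, run, toExpr, Expr.code]
  exact hpair _ (hpair _ (hpair _ (hpair _ (hpair _ (hpair' _ (hpair _ (hpair _ (hpair _ (hpair _
    (hpair _ (hpair _ hincrs)))))))))))

/-- A universal code works: it runs the program numbered by its input on 0. -/
theorem exists_code_halting_undecidable :
    ∃ c : Code, ¬ ComputablePred fun n : ℕ => (c.eval [n]).Dom := by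
  let f : ℕ →. ℕ := fun n => (Nat.Partrec.Code.ofNatCode n).eval 0
  have hf : Partrec f := by
    have : Partrec fun n : ℕ => (Denumerable.ofNat Nat.Partrec.Code n).eval 0 :=
      Nat.Partrec.Code.eval_part.comp (Computable.ofNat _) (Computable.const 0)
    exact this
  obtain ⟨c, hc⟩ := Code.exists_code (Nat.Partrec'.part_iff₁.2 hf)
  refine ⟨c, fun h => ComputablePred.halting_problem 0 ?_⟩
  refine ComputablePred.computable_of_manyOneReducible ⟨Encodable.encode, Computable.encode,
    fun d => ?_⟩ h
  have := hc ⟨[Encodable.encode d], rfl⟩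
  simp only [List.Vector.head] at this
  rw [this]
  have hd : f (Encodable.encode d) = d.eval 0 := by
    change (Denumerable.ofNat Nat.Partrec.Code (Encodable.encode d)).eval 0 = _
    rw [Denumerable.ofNat_encode]
  change (d.eval 0).Dom ↔ _
  rw [← hd]
  rfl

theorem not_semanticInputMembershipDecidable {N : Type u} [Encodable N] (S : Vocabulary N)
    (V : Type v) [Encodable V] [Nonempty V] (dom : Type w) [Countable dom] [Infinite dom]
    {ρ : ListSym → N} (hρ : Function.Injective ρ) (har : ∀ i, S.ar (ρ i) = 2)
    (hiar : ∀ i, S.iar (ρ i) = 1) : ¬ SemanticInputMembershipDecidable S V dom := by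
  rintro ⟨P, hP, hdec⟩
  obtain ⟨c, hc⟩ := exists_code_halting_undecidable
  obtain ⟨e⟩ : Nonempty (dom ≃ List ℕ) := nonempty_equiv_of_countable
  obtain ⟨x⟩ := ‹Nonempty V›
  have hred : ComputablePred fun n : ℕ => ¬ (c.eval [n]).Dom :=
    ComputablePred.computable_of_manyOneReducible
      ⟨fun n => Nat.pair (Encodable.encode x) ((diverges c n).toExpr S x ρ).code,
        (Primrec₂.natPair.comp (Primrec.const _) (primrec_code_diverges x ρ c)).to_comp,
        fun n => by rw [hdec, mem_semInputs_diverges_iff e hρ har hiar]⟩ hP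
  exact hc (hred.not.of_eq fun n => not_not)

end LIF

theorem mainTheorem10 (dom : Type*) [Countable dom] [Infinite dom]
    (V : Type*) [Encodable V] [Nonempty V] :
    ¬ LIF.SemanticInputMembershipDecidable LIF.universalVocabulary V dom ∧
      ∃ (k : ℕ) (S : LIF.Vocabulary (Fin k)),
        ¬ LIF.SemanticInputMembershipDecidable S V dom := by
  -- One module name for each constructor of `ListSym`.
  refine ⟨?_, 9, ⟨⟨0⟩, fun _ => 2, fun _ => 1, fun _ => by norm_num⟩, ?_⟩
  · refine LIF.not_semanticInputMembershipDecidable _ V dom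
      (ρ := fun i => ((LIF.ListSym.idx i : ℕ), 1, 1)) (fun i j h => ?_) (fun _ => rfl) fun _ => rfl
    exact LIF.ListSym.idx_injective (Fin.ext (Prod.mk.inj h).1)
  · exact LIF.not_semanticInputMembershipDecidable _ V dom LIF.ListSym.idx_injective
      (fun _ => rfl) fun _ => rfl
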